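/- **Number of velocity jumps.** Let $d\ge 1$ and $U(x)=|x|^2/2$ on $\mathbb R^d$, so that $\nabla U(x)=x$, and put $n(x)=\nabla U(x)/|\nabla U(x)|$ for $x\ne 0$. Let $\pi^d=N_d(0,I_d)$, let $\mu^d$ be the uniform distribution on the unit sphere $S^{d-1}$, and let $\mu_1$ be the law of the first coordinate under $\mu^d$. Let $q^{\parallel,d}$ be the probability measure on $[0,\infty)$ proportional to $w\,\mu_1(dw)$ (for $d\ge2$ it has the density $(d-1)w(1-w^2)^{(d-3)/2}$ on $(0,1)$; for $d=1$ it is $\delta_1$). For every $x$ let $\nu^x$ be a probability measure, depending measurably on $x$, on the orthogonal matrices $A$ that map $n(x)^\perp$ into itself. Let $Z^d_t=(X^d_t,V^d_t)$, $t\ge 0$, be a Forward Event-Chain Monte Carlo (FECMC) process for $U$ without global refreshment, i.e. the piecewise deterministic Markov process on $\mathbb R^d\times\mathbb R^d$ that moves along $(x,v)\mapsto(x+tv,v)$ between events; has events at the rate $\lambda(x,v)=\max((v\,|\,\nabla U(x)),0)$; and at an event in the state $(x,v)$ keeps $x$ and replaces $v$ by $$v_{\mathrm{new}}=-w\,n(x)+\sqrt{1-w^2}\;\frac{A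 v^\perp}{|v^\perp|},\qquad v^\perp=v-(v\,|\,n(x))\,n(x),$$ where $w\sim q^{\parallel,d}$ and $A\sim\nu^x$ are independent (the last term is $0$ if $v^\perp=0$). Assume that $Z^d$ is stationary with $Z^d_t\sim\pi^d\otimes\mu^d$ for all $t\ge0$. Then, for every $T>0$, the number of velocity jumps on $(0,T]$ is a random variable (measurable up to a null set) and $$\mathbb E\Big[\sum_{0<t\le T}\mathbf 1_{\{\Delta V^d_t\neq 0\}}\Big]=\frac{T}{\sqrt{2\pi}},\qquad \Delta V^d_t=V^d_t-V^d_{t-}.$$ -/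

import Mathlib

open MeasureTheory ProbabilityTheory Filter Topology Set
open scoped NNReal ENNReal Gradient RealInnerProductSpace

namespace FECMC

noncomputable section

/-- Euclidean space of dimension `d`, in which positions and velocities live. -/
abbrev E (d : ℕ) : Type := EuclideanSpace ℝ (Fin d)

/-- Square matrices carry the product sigma-algebra of their entries. -/
instance instMeasurableSpaceMatrix (d : ℕ) : MeasurableSpace (Matrix (Fin d) (Fin d) ℝ) :=
  inferInstanceAs (MeasurableSpace (Fin d → Fin d → ℝ))

/-- The uniform probability distribution on the unit sphere, as a measure on the whole space:
the normalized surface measure. In dimension one it charges `1` and `-1` with mass `1/2` each. -/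
def unifSphere (d : ℕ) : Measure (E d) :=
  (((volume : Measure (E d)).toSphere univ)⁻¹ • (volume : Measure (E d)).toSphere).map
    Subtype.val

/-- The potential of the standard Gaussian distribution, `U x = |x|² / 2`. -/
def gaussPotential (d : ℕ) (x : E d) : ℝ := ‖x‖ ^ 2 / 2

/-- The normalized gradient direction `n(x) = ∇U(x) / |∇U(x)|` (zero where the gradient is). -/
def gradDir {d : ℕ} (U : E d → ℝ) (x : E d) : E d := ‖∇ U x‖⁻¹ • ∇ U x

/-- The event rate without global refreshment, `λ(x, v) = (v | ∇U(x))₊`. -/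
def eventRate {d : ℕ} (U : E d → ℝ) (x v : E d) : ℝ := max ⟪v, ∇ U x⟫ 0

/-- The law of the refreshed radial speed: the probability measure on `[0, ∞)` that is
proportional to `w μ₁(dw)`, where `μ₁` is the first marginal of the velocity distribution (here
the uniform distribution on the sphere). For `d ≥ 2` it has the density
`(d - 1) w (1 - w²)^((d - 3) / 2)` on `(0, 1)`; for `d = 1` it is the Dirac mass at `1`. -/
def radialLaw (d : ℕ) [NeZero d] : Measure ℝ :=
  let m : Measure ℝ := (((unifSphere d).map (fun v : E d => v 0)).restrict (Ici 0)).withDensity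
    (fun w => ENNReal.ofReal w)
  (m univ)⁻¹ • m

/-- The component of `v` orthogonal to the gradient direction at `x`. -/
def perp {d : ℕ} (U : E d → ℝ) (x v : E d) : E d := v - ⟪v, gradDir U x⟫ • gradDir U x

/-- The velocity after an event at `(x, v)`, for the radial speed `w` and the orthogonal matrix
`A`: the component along the gradient becomes `-w n(x)`, and the orthogonal component becomes
`A v^⊥`, renormalized to the length `√(1 - w²)` that makes the new velocity a unit vector. -/
def newVelocity {d : ℕ} (U : E d → ℝ) (x v : E d) (w : ℝ) (A : Matrix (Fin d) (Fin d) ℝ) : E d :=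
  -(w • gradDir U x) + (√(1 - w ^ 2) / ‖perp U x v‖) • Matrix.toEuclideanLin A (perp U x v)

/-- A choice of the switch laws `ν^x`: each `ν^x` is carried by the orthogonal matrices that
leave the hyperplane orthogonal to `n(x)` invariant. -/
def IsSwitchKernel {d : ℕ} (U : E d → ℝ) (ν : Kernel (E d) (Matrix (Fin d) (Fin d) ℝ)) : Prop :=
  IsMarkovKernel ν ∧ ∀ x, ∀ᵐ A ∂(ν x), A ∈ Matrix.orthogonalGroup (Fin d) ℝ ∧
    ∀ u : E d, ⟪u, gradDir U x⟫ = 0 → ⟪Matrix.toEuclideanLin A u, gradDir U x⟫ = 0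

/-- The jump kernel `Q_V((x, v), ·)`: the law of the new velocity when `w` and `A ∼ ν^x` are drawn
independently. -/
def velocityKernel {d : ℕ} [NeZero d] (U : E d → ℝ)
    (ν : Kernel (E d) (Matrix (Fin d) (Fin d) ℝ)) (x v : E d) : Measure (E d) :=
  ((radialLaw d).prod (ν x)).map (fun p => newVelocity U x v p.1 p.2)

/-- The information in the event times and the post-event states up to the `n`-th event. -/
abbrev history {d : ℕ} {Ω : Type*} (S : ℕ → Ω → ℝ) (Y : ℕ → Ω → E d × E d) (n : ℕ) :
    MeasurableSpace Ω :=
  MeasurableSpace.comap (fun ω (i : Finset.Iic n) => (S i ω, Y i ω)) inferInstance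

/-- `S` and `Y` are the event times and the post-event states of the process `Z = (X, V)`, which
is the piecewise deterministic process with linear flow `(x, v) ↦ (x + t v, v)`, event
rate `λ(x, v) = (v | ∇U(x))₊` and FECMC velocity jumps:

* `Z` follows the flow from `Y n` on `[S n, S (n + 1))`;
* given the history up to the `n`-th event, the waiting time for the next event has the
  survival function `t ↦ exp (-∫₀ᵗ λ(x + s v, v) ds)`, where `(x, v) = Y n`;
* at the event the position is continuous, and, given the history and the time of the event, the
  new velocity has the law `Q_V` at the state just before the event.

For the potentials used here the integrated rate along a line with non-zero velocity diverges, so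
that every waiting time is finite. -/
structure IsSkeleton {d : ℕ} [NeZero d] {Ω : Type*} [MeasurableSpace Ω] (P : Measure Ω)
    (U : E d → ℝ) (ν : Kernel (E d) (Matrix (Fin d) (Fin d) ℝ)) (Z : ℝ≥0 → Ω → E d × E d)
    (S : ℕ → Ω → ℝ) (Y : ℕ → Ω → E d × E d) : Prop where
  measurable_time : ∀ n, Measurable (S n)
  measurable_state : ∀ n, Measurable (Y n)
  time_zero : ∀ᵐ ω ∂P, S 0 ω = 0
  flow : ∀ᵐ ω ∂P, ∀ n (t : ℝ≥0), S n ω ≤ t → t < S (n + 1) ω →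
    Z t ω = ((Y n ω).1 + (t - S n ω) • (Y n ω).2, (Y n ω).2)
  position : ∀ᵐ ω ∂P, ∀ n,
    (Y (n + 1) ω).1 = (Y n ω).1 + (S (n + 1) ω - S n ω) • (Y n ω).2
  waiting_time : ∀ n (t : ℝ), 0 ≤ t →
    P⟦{ω | t < S (n + 1) ω - S n ω} | history S Y n⟧ =ᵐ[P]
      fun ω => Real.exp (-∫ s in (0 : ℝ)..t, eventRate U ((Y n ω).1 + s • (Y n ω).2) (Y n ω).2)
  velocity : ∀ n (B : Set (E d)), MeasurableSet B →
    P⟦{ω | (Y (n + 1) ω).2 ∈ B} |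
        history S Y n ⊔ MeasurableSpace.comap (S (n + 1)) inferInstance⟧ =ᵐ[P]
      fun ω => (velocityKernel U ν (Y (n + 1) ω).1 (Y n ω).2).real B

/-- `Z = (X, V)` is an FECMC process (without global refreshment) for the potential `U` and the
switch laws `ν`. -/
def IsFECMC {d : ℕ} [NeZero d] {Ω : Type*} [MeasurableSpace Ω] (P : Measure Ω)
    (U : E d → ℝ) (ν : Kernel (E d) (Matrix (Fin d) (Fin d) ℝ)) (Z : ℝ≥0 → Ω → E d × E d) : Prop :=
  ∃ (S : ℕ → Ω → ℝ) (Y : ℕ → Ω → E d × E d), IsSkeleton P U ν Z S Y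

/-- The jump `ΔV_t = V_t - V_{t-}` of a path `V`; there is none at time `0`. -/
def jump {d : ℕ} (V : ℝ≥0 → E d) (t : ℝ≥0) : E d := V t - Function.leftLim V t

/-- The number of jumps of the path `V` on `(0, T]`, possibly infinite. -/
def numJumps {d : ℕ} (V : ℝ≥0 → E d) (T : ℝ≥0) : ℝ≥0∞ :=
  ({t ∈ Ioc 0 T | jump V t ≠ 0}.encard : ℝ≥0∞)

end

end FECMC

/-! Just before an event the rate is almost surely positive (`IsSkeleton.ae_lineRate_pos`), so the
velocity has a positive component along the gradient, whereas the jump kernel gives no mass to such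
velocities (`velocityKernel_inner_pos`). Hence every event changes the velocity, and the jumps on
`(0, T]` are exactly the events there. The compensator formula `lintegral_waiting_eq` turns the
probability that an event falls before `T` into the mean rate integrated over the preceding flow
segment. Summing over the events, and using Tonelli and stationarity, the mean count is `T` times
the mean of `max ⟪v, x⟫ 0` under `stdGaussian` times `unifSphere`. For a unit vector `v` the inner
product is standard normal, so this mean is the Gaussian density at `0`.

Events could a priori accumulate, and the skeleton says nothing about `Z` from an accumulation time
on. The summed segment rates are nevertheless at most the rate along `Z`, which makes the mean count
finite. Borel–Cantelli (`IsSkeleton.ae_exists_lt`) then excludes accumulation and upgrades the bound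
to an equality. -/

namespace FECMC

noncomputable section

/-! ### Waiting times with a given hazard rate -/

/-- The density of a waiting time with hazard rate `r`. -/
def hazardDensity (r : ℝ → ℝ) (u : ℝ) : ℝ := r u * Real.exp (-∫ s in (0 : ℝ)..u, r s)

lemma continuous_hazardDensity {β : Type*} [TopologicalSpace β] {r : β → ℝ → ℝ}
    (hr : Continuous (Function.uncurry r)) :
    Continuous (fun p : β × ℝ => hazardDensity (r p.1) p.2) := by
  unfold hazardDensity
  refine hr.mul (Real.continuous_exp.comp (Continuous.neg ?_))
  have hr' : Continuous (Function.uncurry fun (p : β × ℝ) (s : ℝ) => r p.1 s) :=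
    hr.comp (by fun_prop : Continuous fun q : (β × ℝ) × ℝ => (q.1.1, q.2))
  exact intervalIntegral.continuous_parametric_intervalIntegral_of_continuous (μ := volume)
    (a₀ := 0) hr' continuous_snd

lemma hazardDensity_nonneg {r : ℝ → ℝ} (h0 : ∀ s, 0 ≤ r s) (u : ℝ) : 0 ≤ hazardDensity r u :=
  mul_nonneg (h0 u) (Real.exp_nonneg _)

lemma setLIntegral_hazardDensity {r : ℝ → ℝ} (hr : Continuous r) (h0 : ∀ s, 0 ≤ r s)
    {a b : ℝ} (hab : a ≤ b) :
    ∫⁻ u in Ioc a b, ENNReal.ofReal (hazardDensity r u) =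
      ENNReal.ofReal (Real.exp (-∫ s in (0 : ℝ)..a, r s)
        - Real.exp (-∫ s in (0 : ℝ)..b, r s)) := by
  have hc : Continuous (hazardDensity r) :=
    (continuous_hazardDensity (β := Unit) (r := fun _ => r) (hr.comp continuous_snd)).comp
      (by fun_prop : Continuous fun u : ℝ => ((), u))
  have hd : ∀ u : ℝ, HasDerivAt (fun u => -Real.exp (-∫ s in (0 : ℝ)..u, r s))
      (hazardDensity r u) u := by
    intro u
    have h1 := ((hr.integral_hasStrictDerivAt 0 u).hasDerivAt.neg.exp).neg
    refine h1.congr_deriv ?_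
    simp only [hazardDensity, Pi.neg_apply]; ring
  rw [← ofReal_integral_eq_lintegral_ofReal, ← intervalIntegral.integral_of_le hab,
    intervalIntegral.integral_eq_sub_of_hasDerivAt (fun u _ => hd u) (hc.intervalIntegrable _ _)]
  · congr 1; ring
  · exact (hc.intervalIntegrable a b).1
  · exact ae_of_all _ fun u => hazardDensity_nonneg h0 u

section Waiting

variable {Ω β : Type*} {m mΩ : MeasurableSpace Ω} {P : Measure Ω} [IsProbabilityMeasure P]
  [MeasurableSpace β] {H : Ω → β} {W : Ω → ℝ}
  {r : β → ℝ → ℝ}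

/-- If `W` has the hazard rate `r (H ω)` given `m`, and `H` is `m`-measurable, this is the
probability that `H ∈ A` and `t < W`. -/
lemma measureReal_inter_lt (hm : m ≤ mΩ) (hH : Measurable[m] H) (hW : Measurable W)
    (hsurv : ∀ t : ℝ, 0 ≤ t → P⟦{ω | t < W ω} | m⟧ =ᵐ[P]
      fun ω => Real.exp (-∫ s in (0 : ℝ)..t, r (H ω) s))
    {A : Set β} (hA : MeasurableSet A) {t : ℝ} (ht : 0 ≤ t) :
    P.real (H ⁻¹' A ∩ {ω | t < W ω}) =
      ∫ ω in H ⁻¹' A, Real.exp (-∫ s in (0 : ℝ)..t, r (H ω) s) ∂P := by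
  have hms : MeasurableSet {ω | t < W ω} := measurableSet_lt measurable_const hW
  have hA' : MeasurableSet[m] (H ⁻¹' A) := hH hA
  rw [← setIntegral_congr_ae (g := fun ω => Real.exp (-∫ s in (0 : ℝ)..t, r (H ω) s))
    (hm _ hA') ((hsurv t ht).mono fun ω h _ => h), setIntegral_condExp hm
    ((integrable_const (1 : ℝ)).indicator hms) hA', setIntegral_indicator hms]
  simp

/-- The survival function equals `1` at time `0`. -/
lemma ae_waiting_pos (hm : m ≤ mΩ) (hH : Measurable[m] H) (hW : Measurable W)
    (hsurv : ∀ t : ℝ, 0 ≤ t → P⟦{ω | t < W ω} | m⟧ =ᵐ[P]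
      fun ω => Real.exp (-∫ s in (0 : ℝ)..t, r (H ω) s)) : ∀ᵐ ω ∂P, 0 < W ω := by
  have h := measureReal_inter_lt hm hH hW hsurv MeasurableSet.univ le_rfl
  have hms : MeasurableSet {ω | 0 < W ω} := measurableSet_lt measurable_const hW
  simp only [preimage_univ, univ_inter, intervalIntegral.integral_same, neg_zero, Real.exp_zero,
    Measure.restrict_univ, integral_const, probReal_univ, smul_eq_mul, mul_one] at h
  rwa [ae_iff, ← compl_ofPred, prob_compl_eq_zero_iff hms, ← ENNReal.toReal_eq_one_iff]

variable [TopologicalSpace β] [BorelSpace β]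

/-- The joint law of the past `H` and of a waiting time `W` with the hazard rate `r H`. -/
lemma map_prodMk_eq_withDensity (hm : m ≤ mΩ) (hH : Measurable[m] H) (hW : Measurable W)
    (hr : Continuous (Function.uncurry r))
    (h0 : ∀ h s, 0 ≤ r h s)
    (hsurv : ∀ t : ℝ, 0 ≤ t → P⟦{ω | t < W ω} | m⟧ =ᵐ[P]
      fun ω => Real.exp (-∫ s in (0 : ℝ)..t, r (H ω) s)) :
    P.map (fun ω => (H ω, W ω)) = ((P.map H).prod (volume.restrict (Ioi 0))).withDensity
      (fun p => ENNReal.ofReal (hazardDensity (r p.1) p.2)) := by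
  have hH' : Measurable H := hH.mono hm le_rfl
  have hHW : Measurable fun ω => (H ω, W ω) := hH'.prodMk hW
  have : IsProbabilityMeasure (P.map (fun ω => (H ω, W ω))) :=
    Measure.isProbabilityMeasure_map hHW.aemeasurable
  have : IsProbabilityMeasure (P.map H) := Measure.isProbabilityMeasure_map hH'.aemeasurable
  have hmeas : Measurable fun p : β × ℝ => ENNReal.ofReal (hazardDensity (r p.1) p.2) :=
    (continuous_hazardDensity hr).measurable.ennreal_ofReal
  have hrc : ∀ h, Continuous (r h) := fun h =>
    hr.comp (by fun_prop : Continuous fun s : ℝ => (h, s))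
  have hΛ : ∀ t : ℝ, Measurable fun h => Real.exp (-∫ s in (0 : ℝ)..t, r h s) := fun t =>
    (Real.continuous_exp.comp (Continuous.neg
      (intervalIntegral.continuous_parametric_intervalIntegral_of_continuous (μ := volume)
        (a₀ := 0) hr (s := fun _ => t) continuous_const))).measurable
  have hΛle : ∀ t : ℝ, 0 ≤ t → ∀ h, Real.exp (-∫ s in (0 : ℝ)..t, r h s) ≤ 1 := fun t ht h =>
    Real.exp_le_one_iff.2 (neg_nonpos.2 (intervalIntegral.integral_nonneg ht fun s _ => h0 h s))
  have hint : ∀ t : ℝ, 0 ≤ t → Integrable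
      (fun ω => Real.exp (-∫ s in (0 : ℝ)..t, r (H ω) s)) P := fun t ht =>
    Integrable.of_bound ((hΛ t).comp hH').aestronglyMeasurable 1 (ae_of_all _ fun ω => by
      rw [Real.norm_of_nonneg (Real.exp_nonneg _)]; exact hΛle t ht _)
  have key : ∀ (A : Set β), MeasurableSet A → ∀ a b : ℝ, a < b →
      P.map (fun ω => (H ω, W ω)) (A ×ˢ Ioc a b) =
      ((P.map H).prod (volume.restrict (Ioi 0))).withDensity
        (fun p => ENNReal.ofReal (hazardDensity (r p.1) p.2)) (A ×ˢ Ioc a b) := by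
    intro A hA a b hab
    -- The survival formula is available only at nonnegative times. Truncating at `0` loses nothing:
    -- one measure lives on `Ioi 0`, and `W` is positive almost surely.
    have hab' : max a 0 ≤ max b 0 := max_le_max_right _ hab.le
    have ha0 : 0 ≤ max a 0 := le_max_right _ _
    have hb0 : 0 ≤ max b 0 := le_max_right _ _
    have hset : Ioc a b ∩ Ioi 0 = Ioc (max a 0) (max b 0) := by
      ext u; simp only [mem_inter_iff, mem_Ioc, mem_Ioi, max_lt_iff, le_max_iff]; grind
    have hHA : MeasurableSet (H ⁻¹' A) := hH' hA
    rw [withDensity_apply _ (hA.prod measurableSet_Ioc), Measure.map_apply hHW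
      (hA.prod measurableSet_Ioc), ← Measure.prod_restrict, Measure.restrict_restrict
      measurableSet_Ioc, hset, lintegral_prod _ hmeas.aemeasurable,
      lintegral_congr fun h => setLIntegral_hazardDensity (hrc h) (h0 h) hab',
      setLIntegral_map (f := fun h => ENNReal.ofReal (Real.exp (-∫ s in (0 : ℝ)..max a 0, r h s)
        - Real.exp (-∫ s in (0 : ℝ)..max b 0, r h s))) hA
        ((hΛ _).sub (hΛ _)).ennreal_ofReal hH',
      ← ofReal_integral_eq_lintegral_ofReal (f := fun ω =>
        Real.exp (-∫ s in (0 : ℝ)..max a 0, r (H ω) s)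
        - Real.exp (-∫ s in (0 : ℝ)..max b 0, r (H ω) s))
        ((hint _ ha0).sub (hint _ hb0)).integrableOn,
      integral_sub (hint _ ha0).integrableOn (hint _ hb0).integrableOn,
      ← measureReal_inter_lt hm hH hW hsurv hA ha0, ← measureReal_inter_lt hm hH hW hsurv hA hb0]
    · have hsub : H ⁻¹' A ∩ {ω | max b 0 < W ω} ⊆ H ⁻¹' A ∩ {ω | max a 0 < W ω} :=
        inter_subset_inter_right _ fun ω h => lt_of_le_of_lt hab' h
      rw [← measureReal_sdiff hsub (hHA.inter (measurableSet_lt measurable_const hW)),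
        ofReal_measureReal]
      refine measure_congr (eventuallyEq_set.2 ?_)
      filter_upwards [ae_waiting_pos hm hH hW hsurv] with ω hω
      simp only [mem_preimage, mem_prod, mem_Ioc, Set.mem_sdiff, mem_inter_iff, mem_ofPred_eq,
        max_lt_iff, hω, and_true]
      rw [← not_lt]
      tauto
    · refine ae_of_all _ fun ω => sub_nonneg.2 (Real.exp_le_exp.2 (neg_le_neg ?_))
      refine intervalIntegral.integral_mono_interval le_rfl ha0 hab'
        (ae_of_all _ fun s => h0 _ s) ((hrc _).intervalIntegrable _ _)
  refine Measure.ext_prod fun {A B} hA hB => ?_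
  -- For fixed `A` both sides become measures on `ℝ`, which half-open intervals determine.
  have hrect : ∀ (μ : Measure (β × ℝ)) (B : Set ℝ), MeasurableSet B →
      μ (A ×ˢ B) = (μ.restrict (A ×ˢ univ)).map Prod.snd B := by
    intro μ B hB
    rw [Measure.map_apply measurable_snd hB, Measure.restrict_apply (measurable_snd hB)]
    congr 1; ext p; simp [and_comm]
  rw [hrect _ B hB, hrect _ B hB]
  congr 1
  refine Measure.ext_of_Ioc _ _ fun a b hab => ?_
  rw [← hrect _ _ measurableSet_Ioc, ← hrect _ _ measurableSet_Ioc]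
  exact key A hA a b hab

/-- Conditioning `f H` on the past gives it the weight of the survival function. -/
lemma lintegral_indicator_lt (hm : m ≤ mΩ) (hH : Measurable[m] H) (hW : Measurable W)
    (hr : Continuous (Function.uncurry r)) (h0 : ∀ h s, 0 ≤ r h s)
    (hsurv : ∀ t : ℝ, 0 ≤ t → P⟦{ω | t < W ω} | m⟧ =ᵐ[P]
      fun ω => Real.exp (-∫ s in (0 : ℝ)..t, r (H ω) s))
    {u : ℝ} (hu : 0 ≤ u) {f : β → ℝ≥0∞} (hf : Measurable f) :
    ∫⁻ ω, {ω | u < W ω}.indicator (fun ω => f (H ω)) ω ∂P =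
      ∫⁻ ω, ENNReal.ofReal (Real.exp (-∫ s in (0 : ℝ)..u, r (H ω) s)) * f (H ω) ∂P := by
  have hH' : Measurable H := hH.mono hm le_rfl
  have hms : MeasurableSet {ω | u < W ω} := measurableSet_lt measurable_const hW
  have hΛ : Measurable fun h => Real.exp (-∫ s in (0 : ℝ)..u, r h s) :=
    (Real.continuous_exp.comp (Continuous.neg
      (intervalIntegral.continuous_parametric_intervalIntegral_of_continuous (μ := volume)
        (a₀ := 0) hr (s := fun _ => u) continuous_const))).measurable
  have hint : Integrable (fun ω => Real.exp (-∫ s in (0 : ℝ)..u, r (H ω) s)) P :=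
    Integrable.of_bound (hΛ.comp hH').aestronglyMeasurable 1 (ae_of_all _ fun ω => by
      rw [Real.norm_of_nonneg (Real.exp_nonneg _)]
      exact Real.exp_le_one_iff.2
        (neg_nonpos.2 (intervalIntegral.integral_nonneg hu fun s _ => h0 _ s)))
  -- It suffices to identify the law of `H` on the event `u < W`, since `f` enters only through that
  -- law.
  have hmap : (P.restrict {ω | u < W ω}).map H = (P.map H).withDensity
      (fun h => ENNReal.ofReal (Real.exp (-∫ s in (0 : ℝ)..u, r h s))) := by
    ext A hA
    rw [Measure.map_apply hH' hA, Measure.restrict_apply (hH' hA), withDensity_apply _ hA,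
      setLIntegral_map hA hΛ.ennreal_ofReal hH',
      ← ofReal_integral_eq_lintegral_ofReal hint.integrableOn
        (ae_of_all _ fun ω => Real.exp_nonneg _),
      ← measureReal_inter_lt hm hH hW hsurv hA hu, ofReal_measureReal]
  rw [lintegral_indicator hms, ← lintegral_map hf hH', hmap,
    lintegral_withDensity_eq_lintegral_mul _ hΛ.ennreal_ofReal hf,
    lintegral_map (hΛ.ennreal_ofReal.mul hf) hH']
  rfl

/-- The compensator formula for a waiting time `W` with the hazard rate `r H`. -/
lemma lintegral_waiting_eq (hm : m ≤ mΩ) (hH : Measurable[m] H) (hW : Measurable W)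
    (hr : Continuous (Function.uncurry r)) (h0 : ∀ h s, 0 ≤ r h s)
    (hsurv : ∀ t : ℝ, 0 ≤ t → P⟦{ω | t < W ω} | m⟧ =ᵐ[P]
      fun ω => Real.exp (-∫ s in (0 : ℝ)..t, r (H ω) s))
    {G : β × ℝ → ℝ≥0∞} (hG : Measurable G) :
    ∫⁻ ω, G (H ω, W ω) ∂P = ∫⁻ ω, (∫⁻ u in Ioi 0,
      {u | u < W ω}.indicator (fun u => ENNReal.ofReal (r (H ω) u) * G (H ω, u)) u) ∂P := by
  have hH' : Measurable H := hH.mono hm le_rfl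
  have hd : Measurable fun p : β × ℝ => ENNReal.ofReal (hazardDensity (r p.1) p.2) :=
    (continuous_hazardDensity hr).measurable.ennreal_ofReal
  have hrG : Measurable fun p : β × ℝ => ENNReal.ofReal (r p.1 p.2) * G p :=
    hr.measurable.ennreal_ofReal.mul hG
  have : IsProbabilityMeasure (P.map H) := Measure.isProbabilityMeasure_map hH'.aemeasurable
  have hmH : Measurable fun q : Ω × ℝ => (H q.1, q.2) :=
    (hH'.comp measurable_fst).prodMk measurable_snd
  rw [← lintegral_map hG (hH'.prodMk hW), map_prodMk_eq_withDensity hm hH hW hr h0 hsurv,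
    lintegral_withDensity_eq_lintegral_mul _ hd hG, lintegral_prod _ (hd.mul hG).aemeasurable,
    lintegral_map (hd.mul hG).lintegral_prod_right' hH']
  -- With the time integral outermost, the two sides agree for each `u`: the exponential factor of
  -- the hazard density is the conditional probability of `u < W`.
  refine (lintegral_lintegral_swap ?_).trans (Eq.trans ?_ (lintegral_lintegral_swap ?_).symm)
  · exact ((hd.mul hG).comp hmH).aemeasurable
  · refine setLIntegral_congr_fun measurableSet_Ioi fun u (hu : 0 < u) => ?_
    have h1 := lintegral_indicator_lt hm hH hW hr h0 hsurv hu.le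
      (f := fun h => ENNReal.ofReal (r h u) * G (h, u)) (hrG.comp measurable_prodMk_right)
    refine Eq.trans (lintegral_congr fun ω => ?_) h1.symm
    simp only [Pi.mul_apply, hazardDensity, ENNReal.ofReal_mul (h0 _ _)]
    ring
  · exact ((hrG.comp hmH).indicator (measurableSet_lt measurable_snd
      (hW.comp measurable_fst))).aemeasurable

end Waiting

/-! ### Gaussian mean rate and direction of the refreshed velocity -/

section Model

variable {d : ℕ}

lemma gradient_gaussPotential (x : E d) : ∇ (gaussPotential d) x = x := by
  refine HasGradientAt.gradient ?_
  rw [hasGradientAt_iff_hasFDerivAt]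
  have h : HasFDerivAt (fun y : E d => ‖y‖ ^ 2 / 2) ((2 : ℝ)⁻¹ • (2 • (innerSL ℝ) x)) x := by
    simpa [div_eq_inv_mul] using ((hasStrictFDerivAt_norm_sq x).hasFDerivAt.const_mul (2 : ℝ)⁻¹)
  refine h.congr_fderiv ?_
  ext y
  simp

lemma eventRate_gaussPotential (x v : E d) :
    eventRate (gaussPotential d) x v = max ⟪v, x⟫ 0 := by
  rw [eventRate, gradient_gaussPotential]

lemma gradDir_gaussPotential (x : E d) : gradDir (gaussPotential d) x = ‖x‖⁻¹ • x := by
  rw [gradDir, gradient_gaussPotential]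

/-- The negative of the Gaussian density is an antiderivative of `y` times the density, so the value
is the density at `0`. -/
lemma lintegral_posPart_gaussianReal :
    ∫⁻ y, ENNReal.ofReal (max y 0) ∂(gaussianReal 0 1) =
      ENNReal.ofReal (1 / √(2 * Real.pi)) := by
  have hd : ∀ y : ℝ, HasDerivAt (fun y => -gaussianPDFReal 0 1 y)
      (y * gaussianPDFReal 0 1 y) y := by
    intro y
    simp only [gaussianPDFReal_def, NNReal.coe_one, mul_one, sub_zero]
    have h1 : HasDerivAt (fun y : ℝ => -y ^ 2 / 2) (-y) y := by
      refine (((hasDerivAt_pow 2 y).neg).div_const 2).congr_deriv ?_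
      simp only [Nat.add_one_sub_one, pow_one, Nat.cast_ofNat]
      ring
    refine ((h1.exp.const_mul (√(2 * Real.pi))⁻¹).neg).congr_deriv ?_
    ring
  have ht : Tendsto (fun y => -gaussianPDFReal 0 1 y) atTop (𝓝 0) := by
    rw [← neg_zero]
    refine Tendsto.neg ?_
    simp only [gaussianPDFReal_def, NNReal.coe_one, mul_one]
    rw [← mul_zero (√(2 * Real.pi))⁻¹]
    refine Tendsto.const_mul _ (Real.tendsto_exp_atBot.comp ?_)
    have := (tendsto_pow_atTop (α := ℝ) (n := 2) (by norm_num)).atTop_div_const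
      (by norm_num : (0 : ℝ) < 2)
    refine (tendsto_neg_atTop_atBot.comp this).congr fun y => ?_
    simp [neg_div]
  have hpos : ∀ y ∈ Ioi (0 : ℝ), 0 ≤ y * gaussianPDFReal 0 1 y := fun y hy =>
    mul_nonneg (le_of_lt hy) (gaussianPDFReal_nonneg _ _ _)
  have hi := integral_Ioi_of_hasDerivAt_of_nonneg' (fun y _ => hd y) hpos ht
  have hint := integrableOn_Ioi_deriv_of_nonneg' (fun y _ => hd y) hpos ht
  rw [gaussianReal_of_var_ne_zero _ one_ne_zero, lintegral_withDensity_eq_lintegral_mul _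
    (measurable_gaussianPDF 0 1) (by fun_prop)]
  have h2 : (fun y => (gaussianPDF 0 1 * fun y => ENNReal.ofReal (max y 0)) y) =
      (Ioi 0).indicator fun y => ENNReal.ofReal (y * gaussianPDFReal 0 1 y) := by
    ext y
    rcases le_or_gt y 0 with hy | hy
    · simp [hy]
    · simp [hy, gaussianPDF, ENNReal.ofReal_mul hy.le, mul_comm]
  rw [h2, lintegral_indicator measurableSet_Ioi, ← ofReal_integral_eq_lintegral_ofReal hint
    ((ae_restrict_mem measurableSet_Ioi).mono hpos), hi]
  simp [gaussianPDFReal_def]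

lemma map_inner_stdGaussian {v : E d} (hv : ‖v‖ = 1) :
    (stdGaussian (E d)).map (fun x => ⟪v, x⟫) = gaussianReal 0 1 := by
  have h := IsGaussian.map_eq_gaussianReal (μ := stdGaussian (E d)) (innerSL ℝ v)
  rw [integral_strongDual_stdGaussian, variance_dual_stdGaussian] at h
  simpa [hv] using h

instance isProbabilityMeasure_unifSphere [NeZero d] : IsProbabilityMeasure (unifSphere d) := by
  have : Nonempty (Fin d) := ⟨0⟩
  have : IsProbabilityMeasure (((volume : Measure (E d)).toSphere univ)⁻¹ •
      (volume : Measure (E d)).toSphere) := by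
    refine ⟨?_⟩
    rw [Measure.smul_apply, smul_eq_mul, ENNReal.inv_mul_cancel]
    · exact Measure.measure_univ_ne_zero.2 (Measure.toSphere_ne_zero _)
    · exact measure_ne_top _ _
  exact Measure.isProbabilityMeasure_map measurable_subtype_coe.aemeasurable

lemma ae_norm_eq_one_unifSphere : ∀ᵐ v ∂(unifSphere d), ‖v‖ = 1 := by
  rw [unifSphere, ae_map_iff measurable_subtype_coe.aemeasurable
    (measurableSet_eq_fun measurable_norm measurable_const)]
  exact ae_of_all _ fun v => by simp

/-- The mean event rate in the stationary distribution. -/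
lemma lintegral_eventRate_stationary [NeZero d] :
    ∫⁻ z, ENNReal.ofReal (eventRate (gaussPotential d) z.1 z.2)
      ∂((stdGaussian (E d)).prod (unifSphere d)) = ENNReal.ofReal (1 / √(2 * Real.pi)) := by
  simp only [eventRate_gaussPotential]
  rw [lintegral_prod_symm _ (by fun_prop)]
  have h : ∀ᵐ v ∂(unifSphere d), ∫⁻ x, ENNReal.ofReal (max ⟪v, x⟫ 0) ∂(stdGaussian (E d)) =
      ENNReal.ofReal (1 / √(2 * Real.pi)) := by
    filter_upwards [ae_norm_eq_one_unifSphere] with v hv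
    rw [← lintegral_posPart_gaussianReal, ← map_inner_stdGaussian hv,
      lintegral_map (by fun_prop) (by fun_prop)]
  rw [lintegral_congr_ae h]
  simp

lemma ae_nonneg_radialLaw [NeZero d] : ∀ᵐ w ∂(radialLaw d), 0 ≤ w := by
  refine Measure.ae_smul_measure ?_ _
  refine (withDensity_absolutelyContinuous _ _).ae_le ?_
  exact ae_restrict_mem measurableSet_Ici

/-- The rotated part stays orthogonal to the gradient direction, so only the term with `-w`
contributes. -/
lemma inner_newVelocity_nonpos {x v : E d} {w : ℝ} (hw : 0 ≤ w) {A : Matrix (Fin d) (Fin d) ℝ}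
    {U : E d → ℝ} (hA : ∀ u : E d, ⟪u, gradDir U x⟫ = 0 →
      ⟪Matrix.toEuclideanLin A u, gradDir U x⟫ = 0) :
    ⟪newVelocity U x v w A, gradDir U x⟫ ≤ 0 := by
  have hp : ⟪perp U x v, gradDir U x⟫ = 0 := by
    rw [perp, inner_sub_left, inner_smul_left, real_inner_self_eq_norm_sq]
    by_cases h : ∇ U x = 0
    · simp [gradDir, h]
    · have : ‖gradDir U x‖ = 1 := by
        rw [gradDir, norm_smul, norm_inv, norm_norm, inv_mul_cancel₀ (norm_ne_zero_iff.2 h)]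
      simp [this]
  rw [newVelocity, inner_add_left, inner_neg_left, inner_smul_left, inner_smul_left, hA _ hp,
    mul_zero, add_zero, neg_nonpos]
  exact mul_nonneg hw real_inner_self_nonneg

/-- After an event the velocity does not point upwards. -/
lemma velocityKernel_inner_pos [NeZero d] {U : E d → ℝ}
    {ν : Kernel (E d) (Matrix (Fin d) (Fin d) ℝ)} (hν : IsSwitchKernel U ν) (x v : E d) :
    velocityKernel U ν x v {y | 0 < ⟪y, gradDir U x⟫} = 0 := by
  have hms : MeasurableSet {y : E d | 0 < ⟪y, gradDir U x⟫} :=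
    measurableSet_lt measurable_const (by fun_prop)
  have := hν.1
  rw [velocityKernel]
  -- Without measurability `Measure.map` is the zero measure by convention, and the claim is
  -- trivial.
  by_cases hm : AEMeasurable (fun p : ℝ × Matrix (Fin d) (Fin d) ℝ =>
      newVelocity U x v p.1 p.2) ((radialLaw d).prod (ν x))
  · have : SFinite (radialLaw d) := by unfold radialLaw; infer_instance
    rw [Measure.map_apply_of_aemeasurable hm hms, ← compl_compl (_ ⁻¹' _), ← mem_ae_iff]
    filter_upwards [Measure.quasiMeasurePreserving_fst.ae ae_nonneg_radialLaw,
      Measure.quasiMeasurePreserving_snd.ae (hν.2 x)] with p hp hA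
    exact not_lt.2 (inner_newVelocity_nonpos hp hA.2)
  · simp [Measure.map_of_not_aemeasurable hm]

/-- An event does not happen where its conditional probability vanishes. -/
lemma ae_condExp_ne_zero {Ω : Type*} {m mΩ : MeasurableSpace Ω} {P : Measure Ω}
    [IsFiniteMeasure P] (hm : m ≤ mΩ) {A : Set Ω} (hA : MeasurableSet A) {g : Ω → ℝ}
    (hg : P⟦A | m⟧ =ᵐ[P] g) : ∀ᵐ ω ∂P, ω ∈ A → g ω ≠ 0 := by
  set f := P⟦A | m⟧ with hf
  -- The zero set of the conditional probability belongs to `m`, so integrating over it gives the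
  -- probability of its intersection with `A`.
  have hms : MeasurableSet[m] (f ⁻¹' {0}) :=
    stronglyMeasurable_condExp.measurable (measurableSet_singleton 0)
  have h := setIntegral_condExp hm ((integrable_const (1 : ℝ)).indicator hA) hms (μ := P)
  rw [← hf, setIntegral_congr_fun (g := fun _ => (0 : ℝ)) (hm _ hms) fun ω hω => hω,
    setIntegral_indicator hA] at h
  have h0 : P (f ⁻¹' {0} ∩ A) = 0 := by
    simpa [measureReal_def, ENNReal.toReal_eq_zero_iff] using h.symm
  filter_upwards [hg, measure_eq_zero_iff_ae_notMem.1 h0] with ω h1 h2 hω h3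
  exact h2 ⟨h1.trans h3, hω⟩

end Model

/-! ### Jumps and rates along a single path -/

section Path

variable {d : ℕ} {S : ℕ → ℝ} {Y : ℕ → E d × E d} {Z : ℝ≥0 → E d × E d}

/-- The path `Z` follows the linear flow from `Y n` between the times `S n` and `S (n + 1)`. -/
def FollowsFlow (Z : ℝ≥0 → E d × E d) (S : ℕ → ℝ) (Y : ℕ → E d × E d) : Prop :=
  ∀ n (t : ℝ≥0), S n ≤ t → t < S (n + 1) → Z t = ((Y n).1 + (t - S n) • (Y n).2, (Y n).2)

lemma exists_mem_Ico_of_lt (h0 : S 0 = 0) {t : ℝ} (ht0 : 0 ≤ t) (ht : ∃ n, t < S n) :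
    ∃ n, t ∈ Ico (S n) (S (n + 1)) := by
  classical
  have hpos : Nat.find ht ≠ 0 := fun h => by
    have := Nat.find_spec ht
    rw [h, h0] at this
    exact absurd this (not_lt.2 ht0)
  obtain ⟨k, hk⟩ := Nat.exists_eq_succ_of_ne_zero hpos
  refine ⟨k, not_lt.1 (Nat.find_min ht (by lia)), ?_⟩
  rw [← Nat.succ_eq_add_one, ← hk]
  exact Nat.find_spec ht

lemma eq_of_mem_Ico (hS : StrictMono S) {t : ℝ} {m n : ℕ} (hm : t ∈ Ico (S m) (S (m + 1)))
    (hn : t ∈ Ico (S n) (S (n + 1))) : m = n := by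
  have h1 := hS.lt_iff_lt.1 (hm.1.trans_lt hn.2)
  have h2 := hS.lt_iff_lt.1 (hn.1.trans_lt hm.2)
  lia

lemma FollowsFlow.leftLim_eq (hf : FollowsFlow Z S Y) (h0 : ∀ n, 0 ≤ S n) {n : ℕ} {t : ℝ≥0}
    (h1 : S n < t) (h2 : t ≤ S (n + 1)) : Function.leftLim (fun t => (Z t).2) t = (Y n).2 := by
  have hlt : (S n).toNNReal < t := by
    rw [Real.toNNReal_lt_iff_lt_coe (h0 n)]; exact h1
  -- `Function.leftLim` is a genuine limit only where the left neighbourhood filter is nontrivial.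
  have : (𝓝[<] t).NeBot := nhdsLT_neBot_of_exists_lt ⟨_, hlt⟩
  refine leftLim_eq_of_tendsto (tendsto_const_nhds.congr' ?_)
  filter_upwards [Ioo_mem_nhdsLT hlt] with u hu
  rw [hf n u ((Real.toNNReal_lt_iff_lt_coe (h0 n)).1 hu.1).le
    (lt_of_lt_of_le (NNReal.coe_lt_coe.2 hu.2) h2)]

/-- If every event changes the velocity, and `T` precedes some event, the velocity jumps on
`(0, T]` are the events. -/
lemma FollowsFlow.numJumps_eq (hf : FollowsFlow Z S Y) (h0 : S 0 = 0) (hS : StrictMono S)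
    (hV : ∀ n, (Y (n + 1)).2 ≠ (Y n).2) {T : ℝ≥0} (hT : ∃ n, T < S n) :
    numJumps (fun t => (Z t).2) T = ∑' n, {n | S (n + 1) ≤ T}.indicator (1 : ℕ → ℝ≥0∞) n := by
  have hnn : ∀ n, 0 ≤ S n := fun n => h0 ▸ hS.monotone (Nat.zero_le n)
  have hev : ∀ n, jump (fun t => (Z t).2) (S (n + 1)).toNNReal = (Y (n + 1)).2 - (Y n).2 := by
    intro n
    have hc : ((S (n + 1)).toNNReal : ℝ) = S (n + 1) := Real.coe_toNNReal _ (hnn _)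
    rw [jump, hf.leftLim_eq hnn (n := n) (by rw [hc]; exact hS (Nat.lt_succ_self n)) hc.le,
      hf (n + 1) _ hc.ge (by rw [hc]; exact hS (Nat.lt_succ_self _))]
  have hset : {t ∈ Ioc 0 T | jump (fun t => (Z t).2) t ≠ 0} =
      (fun n => (S (n + 1)).toNNReal) '' {n | S (n + 1) ≤ T} := by
    ext t
    constructor
    · rintro ⟨⟨ht0, htT⟩, hj⟩
      obtain ⟨N, hN⟩ := hT
      obtain ⟨n, hn1, hn2⟩ := exists_mem_Ico_of_lt h0 t.coe_nonneg
        ⟨N, lt_of_le_of_lt (NNReal.coe_le_coe.2 htT) hN⟩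
      rcases hn1.lt_or_eq with hlt | heq
      · refine absurd ?_ hj
        rw [jump, hf.leftLim_eq hnn hlt hn2.le, hf n t hn1 hn2, sub_self]
      · obtain ⟨k, rfl⟩ : ∃ k, n = k + 1 := Nat.exists_eq_succ_of_ne_zero fun h => by
          rw [h, h0] at heq
          exact ht0.ne (NNReal.coe_injective heq)
        refine ⟨k, ?_, ?_⟩
        · exact heq.le.trans (NNReal.coe_le_coe.2 htT)
        · simp only [heq, Real.toNNReal_coe]
    · rintro ⟨n, hn, rfl⟩
      refine ⟨⟨?_, Real.toNNReal_le_iff_le_coe.2 hn⟩, ?_⟩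
      · rw [Real.toNNReal_pos, ← h0]
        exact hS (Nat.succ_pos n)
      · rw [hev]
        exact sub_ne_zero.2 (hV n)
  have hinj : Function.Injective fun n => (S (n + 1)).toNNReal := fun m n hmn =>
    Nat.succ_injective (hS.injective ((Real.toNNReal_eq_toNNReal_iff (hnn _) (hnn _)).1 hmn))
  rw [numJumps, hset, hinj.encard_image, ← ENNReal.tsum_set_one, ← tsum_subtype]
  rfl

/-- The event rate at time `s` along the path that follows the flow from `Y n` after `S n`, for
`s` in `[S n, S (n + 1))`. -/
def stepRate (U : E d → ℝ) (S : ℕ → ℝ) (Y : ℕ → E d × E d) (n : ℕ) (s : ℝ) : ℝ≥0∞ :=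
  (Ico (S n) (S (n + 1))).indicator
    (fun s => ENNReal.ofReal (eventRate U ((Y n).1 + (s - S n) • (Y n).2) (Y n).2)) s

lemma FollowsFlow.tsum_stepRate_eq (hf : FollowsFlow Z S Y) (hS : StrictMono S)
    (U : E d → ℝ) {s : ℝ≥0} {n : ℕ} (hn : (s : ℝ) ∈ Ico (S n) (S (n + 1))) :
    ∑' n, stepRate U S Y n s = ENNReal.ofReal (eventRate U (Z s).1 (Z s).2) := by
  rw [tsum_eq_single n fun m hm => ?_, stepRate, indicator_of_mem hn, hf n s hn.1 hn.2]
  exact indicator_of_notMem (fun h => hm (eq_of_mem_Ico hS h hn)) _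

/-- If the event times accumulate at or before `s`, no segment contains `s` and the sum vanishes.
The bound thus needs no assumption of non-explosion. -/
lemma FollowsFlow.tsum_stepRate_le (hf : FollowsFlow Z S Y) (hS : StrictMono S)
    (U : E d → ℝ) (s : ℝ≥0) :
    ∑' n, stepRate U S Y n s ≤ ENNReal.ofReal (eventRate U (Z s).1 (Z s).2) := by
  by_cases h : ∃ n, (s : ℝ) ∈ Ico (S n) (S (n + 1))
  · obtain ⟨n, hn⟩ := h
    exact (hf.tsum_stepRate_eq hS U hn).le
  · have : ∀ n, stepRate U S Y n s = 0 := fun n =>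
      indicator_of_notMem (fun hn => h ⟨n, hn⟩) _
    simp [this]

end Path

/-! ### Expected number of events of the stationary process -/

section Skeleton

variable {d : ℕ} [NeZero d] {Ω : Type*} [mΩ : MeasurableSpace Ω] {P : Measure Ω}
  {ν : Kernel (E d) (Matrix (Fin d) (Fin d) ℝ)}
  {Z : ℝ≥0 → Ω → E d × E d} {S : ℕ → Ω → ℝ} {Y : ℕ → Ω → E d × E d}

omit [NeZero d] in
lemma history_le (hS : ∀ n, Measurable (S n)) (hY : ∀ n, Measurable (Y n)) (n : ℕ) :
    history S Y n ≤ mΩ :=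
  Measurable.comap_le (measurable_pi_lambda _ fun i => (hS i).prodMk (hY i))

omit [NeZero d] mΩ in
lemma measurable_history (n : ℕ) : Measurable[history S Y n] fun ω => (S n ω, Y n ω) :=
  (measurable_pi_apply (X := fun _ : Finset.Iic n => ℝ × E d × E d)
    ⟨n, Finset.mem_Iic.2 le_rfl⟩).comp
    (comap_measurable fun ω (i : Finset.Iic n) => (S i ω, Y i ω))

/-- The event rate along the line that starts in the state `h.2`. -/
def lineRate (h : ℝ × E d × E d) (s : ℝ) : ℝ :=
  eventRate (gaussPotential d) (h.2.1 + s • h.2.2) h.2.2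

omit [NeZero d] in
lemma continuous_lineRate : Continuous (Function.uncurry (lineRate (d := d))) := by
  have : Function.uncurry (lineRate (d := d)) =
      fun p => max ⟪p.1.2.2, p.1.2.1 + p.2 • p.1.2.2⟫ 0 := by
    ext p
    exact eventRate_gaussPotential _ _
  rw [this]
  fun_prop

omit [NeZero d] in
lemma lineRate_nonneg (h : ℝ × E d × E d) (s : ℝ) : 0 ≤ lineRate h s := le_max_right _ _

variable (hsk : IsSkeleton P (gaussPotential d) ν Z S Y)
include hsk

lemma IsSkeleton.measurable_waiting (n : ℕ) : Measurable fun ω => S (n + 1) ω - S n ω :=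
  (hsk.measurable_time _).sub (hsk.measurable_time _)

variable [IsProbabilityMeasure P]

lemma IsSkeleton.ae_strictMono : ∀ᵐ ω ∂P, StrictMono fun n => S n ω := by
  have h : ∀ n, ∀ᵐ ω ∂P, 0 < S (n + 1) ω - S n ω := fun n =>
    ae_waiting_pos (r := lineRate) (history_le hsk.measurable_time hsk.measurable_state n)
      (measurable_history n) (hsk.measurable_waiting n) (hsk.waiting_time n)
  filter_upwards [ae_all_iff.2 h] with ω hω
  exact strictMono_nat_of_lt_succ fun n => sub_pos.1 (hω n)

lemma IsSkeleton.lintegral_waiting (n : ℕ) {G : (ℝ × E d × E d) × ℝ → ℝ≥0∞} (hG : Measurable G) :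
    ∫⁻ ω, G ((S n ω, Y n ω), S (n + 1) ω - S n ω) ∂P = ∫⁻ ω, (∫⁻ u in Ioi 0,
      {u | u < S (n + 1) ω - S n ω}.indicator
        (fun u => ENNReal.ofReal (lineRate (S n ω, Y n ω) u) * G ((S n ω, Y n ω), u)) u) ∂P :=
  lintegral_waiting_eq (history_le hsk.measurable_time hsk.measurable_state n)
    (measurable_history n) (hsk.measurable_waiting n) continuous_lineRate lineRate_nonneg
    (hsk.waiting_time n) hG

/-- The event rate is positive just before an event. -/
lemma IsSkeleton.ae_lineRate_pos (n : ℕ) :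
    ∀ᵐ ω ∂P, 0 < lineRate (S n ω, Y n ω) (S (n + 1) ω - S n ω) := by
  obtain ⟨D, hD, hms⟩ : ∃ D : Set ((ℝ × E d × E d) × ℝ),
      (∀ p, p ∈ D ↔ lineRate p.1 p.2 = 0) ∧ MeasurableSet D :=
    ⟨{p | lineRate p.1 p.2 = 0}, fun _ => Iff.rfl,
      measurableSet_eq_fun continuous_lineRate.measurable measurable_const⟩
  have hmp : Measurable fun ω => ((S n ω, Y n ω), S (n + 1) ω - S n ω) :=
    ((hsk.measurable_time n).prodMk (hsk.measurable_state n)).prodMk (hsk.measurable_waiting n)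
  have hDm : Measurable (D.indicator (1 : (ℝ × E d × E d) × ℝ → ℝ≥0∞)) :=
    measurable_one.indicator hms
  -- Testing the compensator formula with the indicator of the zero set of the rate makes the
  -- right-hand side vanish.
  have h := hsk.lintegral_waiting n hDm
  have hz : ∀ ω, (∫⁻ u in Ioi 0, {u | u < S (n + 1) ω - S n ω}.indicator
      (fun u => ENNReal.ofReal (lineRate (S n ω, Y n ω) u) *
        D.indicator (1 : (ℝ × E d × E d) × ℝ → ℝ≥0∞) ((S n ω, Y n ω), u)) u) = 0 := by
    intro ω
    refine (lintegral_congr fun u => ?_).trans lintegral_zero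
    refine indicator_apply_eq_zero.2 fun _ => ?_
    by_cases hu : ((S n ω, Y n ω), u) ∈ D
    · rw [(hD _).1 hu, ENNReal.ofReal_zero, zero_mul]
    · rw [indicator_of_notMem hu, mul_zero]
  rw [lintegral_congr hz, lintegral_zero] at h
  filter_upwards [(lintegral_eq_zero_iff (hDm.comp hmp)).1 h] with ω hω
  refine (lineRate_nonneg _ _).lt_of_ne fun h0 => ?_
  have hmem : ((S n ω, Y n ω), S (n + 1) ω - S n ω) ∈ D := (hD _).2 h0.symm
  rw [Function.comp_apply, indicator_of_mem hmem] at hω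
  exact one_ne_zero hω

/-- An unchanged velocity would lie in the open half-space of upward directions, which is null for
the jump kernel. This half-space depends on `ω`, while the conditional law is specified almost
surely for one fixed set at a time; a countable basis of open sets bridges the gap. -/
lemma IsSkeleton.ae_velocity_ne (hν : IsSwitchKernel (gaussPotential d) ν) (n : ℕ) :
    ∀ᵐ ω ∂P, (Y (n + 1) ω).2 ≠ (Y n ω).2 := by
  have hm : history S Y n ⊔ MeasurableSpace.comap (S (n + 1)) inferInstance ≤ mΩ :=
    sup_le (history_le hsk.measurable_time hsk.measurable_state n)
      (hsk.measurable_time _).comap_le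
  have hB : ∀ᵐ ω ∂P, ∀ b ∈ TopologicalSpace.countableBasis (E d), (Y (n + 1) ω).2 ∈ b →
      (velocityKernel (gaussPotential d) ν (Y (n + 1) ω).1 (Y n ω).2).real b ≠ 0 := by
    rw [ae_ball_iff (TopologicalSpace.countable_countableBasis _)]
    intro b hb
    have hbm : MeasurableSet b := (TopologicalSpace.isOpen_of_mem_countableBasis hb).measurableSet
    exact ae_condExp_ne_zero hm ((hsk.measurable_state (n + 1)).snd hbm) (hsk.velocity n b hbm)
  filter_upwards [hB, hsk.ae_lineRate_pos n, hsk.position] with ω hb hr hx heq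
  have hx0 : 0 < ⟪(Y n ω).2, (Y (n + 1) ω).1⟫ := by
    rw [lineRate, eventRate_gaussPotential, ← hx n] at hr
    simpa using hr
  set x := (Y (n + 1) ω).1
  have hopen : IsOpen {y : E d | 0 < ⟪y, gradDir (gaussPotential d) x⟫} :=
    isOpen_lt continuous_const (by fun_prop)
  have hmem : (Y (n + 1) ω).2 ∈ {y : E d | 0 < ⟪y, gradDir (gaussPotential d) x⟫} := by
    have hx1 : x ≠ 0 := fun h => by simp [h] at hx0
    rw [mem_ofPred_eq, heq, gradDir_gaussPotential, inner_smul_right]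
    exact mul_pos (inv_pos.2 (norm_pos_iff.2 hx1)) hx0
  obtain ⟨b, hbb, hyb, hbs⟩ :=
    (TopologicalSpace.isBasis_countableBasis (E d)).exists_subset_of_mem_open hmem hopen
  refine hb b hbb hyb ?_
  rw [measureReal_def, measure_mono_null hbs (velocityKernel_inner_pos hν x _), ENNReal.toReal_zero]

/-- The probability that the `(n + 1)`-st event takes place before time `T` is the mean integrated
event rate after the `n`-th event. -/
lemma IsSkeleton.measure_event_le (n : ℕ) (T : ℝ≥0) :
    P {ω | S (n + 1) ω ≤ T} = ∫⁻ ω, (∫⁻ s in Icc 0 (T : ℝ),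
      stepRate (gaussPotential d) (fun k => S k ω) (fun k => Y k ω) n s) ∂P := by
  have hms : MeasurableSet {p : (ℝ × E d × E d) × ℝ | p.1.1 + p.2 ≤ T} :=
    measurableSet_le (by fun_prop) measurable_const
  have h := hsk.lintegral_waiting n (measurable_one.indicator hms)
  have hl : ∀ ω, {p : (ℝ × E d × E d) × ℝ | p.1.1 + p.2 ≤ T}.indicator
      (1 : (ℝ × E d × E d) × ℝ → ℝ≥0∞) ((S n ω, Y n ω), S (n + 1) ω - S n ω) = {ω | S (n + 1) ω ≤ T}.indicator 1 ω := by
    intro ω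
    simp [indicator_apply]
  rw [lintegral_congr hl, lintegral_indicator_one
    (measurableSet_le (hsk.measurable_time _) measurable_const)] at h
  rw [h]
  refine lintegral_congr_ae ?_
  filter_upwards [hsk.time_zero, hsk.ae_strictMono] with ω h0 hmono
  have hn : 0 ≤ S n ω := h0 ▸ hmono.monotone (Nat.zero_le n)
  -- The shift by `S n ω` passes from time since the last event to absolute time; closing the
  -- half-line at `0` matches the `Ico` in `stepRate`.
  rw [setLIntegral_congr Ioi_ae_eq_Ici, ← lintegral_indicator measurableSet_Ici,
    ← lintegral_indicator measurableSet_Icc, ← lintegral_sub_right_eq_self _ (S n ω)]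
  refine lintegral_congr fun s => ?_
  simp only [stepRate, indicator_apply, mem_Ici, mem_Icc, mem_Ico, mem_ofPred_eq, sub_nonneg,
    sub_lt_sub_iff_right, add_sub_cancel, lineRate, Pi.one_apply, mul_ite, mul_one, mul_zero]
  grind

omit [IsProbabilityMeasure P] in
lemma IsSkeleton.measurable_stepRate (n : ℕ) : Measurable fun p : Ω × ℝ =>
    stepRate (gaussPotential d) (fun k => S k p.1) (fun k => Y k p.1) n p.2 := by
  have h1 : Measurable fun p : Ω × ℝ => S n p.1 := (hsk.measurable_time n).comp measurable_fst
  have h2 : Measurable fun p : Ω × ℝ => S (n + 1) p.1 :=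
    (hsk.measurable_time (n + 1)).comp measurable_fst
  have h3 : Measurable fun p : Ω × ℝ => Y n p.1 := (hsk.measurable_state n).comp measurable_fst
  have hr : Measurable fun p : Ω × ℝ => ENNReal.ofReal
      (lineRate (S n p.1, Y n p.1) (p.2 - S n p.1)) :=
    (continuous_lineRate.measurable.comp
      ((h1.prodMk h3).prodMk (measurable_snd.sub h1))).ennreal_ofReal
  exact hr.indicator ((measurableSet_le h1 measurable_snd).inter
    (measurableSet_lt measurable_snd h2))

lemma IsSkeleton.tsum_measure_event_le (T : ℝ≥0) :
    ∑' n, P {ω | S (n + 1) ω ≤ T} = ∫⁻ s in Icc 0 (T : ℝ), (∫⁻ ω,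
      ∑' n, stepRate (gaussPotential d) (fun k => S k ω) (fun k => Y k ω) n s ∂P) := by
  have hmeas := hsk.measurable_stepRate
  rw [tsum_congr fun n => hsk.measure_event_le n T, ← lintegral_tsum
    fun n => (hmeas n).lintegral_prod_right'.aemeasurable]
  rw [lintegral_lintegral_swap (μ := volume.restrict (Icc 0 (T : ℝ))) (ν := P)
    (f := fun s ω => ∑' n, stepRate (gaussPotential d) (fun k => S k ω) (fun k => Y k ω) n s)]
  · refine lintegral_congr fun ω => (lintegral_tsum fun n => ?_).symm
    exact ((hmeas n).comp measurable_prodMk_left).aemeasurable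
  · exact (Measurable.tsum fun n => (hmeas n).comp measurable_swap).aemeasurable

omit [IsProbabilityMeasure P] in
lemma IsSkeleton.ae_followsFlow :
    ∀ᵐ ω ∂P, FollowsFlow (fun t => Z t ω) (fun k => S k ω) (fun k => Y k ω) := by
  filter_upwards [hsk.flow] with ω h n t using h n t

omit hsk [IsProbabilityMeasure P] in
lemma lintegral_eventRate_eq
    (hstat : ∀ t, P.map (Z t) = (stdGaussian (E d)).prod (unifSphere d)) (t : ℝ≥0) :
    ∫⁻ ω, ENNReal.ofReal (eventRate (gaussPotential d) (Z t ω).1 (Z t ω).2) ∂P =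
      ENNReal.ofReal (1 / √(2 * Real.pi)) := by
  -- A non-measurable `Z t` would have zero image measure, not a probability law.
  have hZ : AEMeasurable (Z t) P := by
    refine AEMeasurable.of_map_ne_zero ?_
    rw [hstat]
    exact IsProbabilityMeasure.ne_zero _
  rw [← lintegral_eventRate_stationary (d := d), ← hstat t, lintegral_map' _ hZ]
  simp only [eventRate_gaussPotential]
  fun_prop

/-- There are almost surely finitely many events on `[0, T]`. -/
lemma IsSkeleton.ae_exists_lt
    (hstat : ∀ t, P.map (Z t) = (stdGaussian (E d)).prod (unifSphere d)) (T : ℝ≥0) :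
    ∀ᵐ ω ∂P, ∃ n, (T : ℝ) < S n ω := by
  -- This is the Borel–Cantelli hypothesis; only the inequality `FollowsFlow.tsum_stepRate_le` may
  -- be used here, since non-explosion is still to be proved.
  have hfin : ∑' n, P {ω | S (n + 1) ω ≤ T} ≠ ∞ := by
    rw [hsk.tsum_measure_event_le]
    refine ne_top_of_le_ne_top (b := ∫⁻ s in Icc 0 (T : ℝ), ENNReal.ofReal (1 / √(2 * Real.pi)))
      ?_ (setLIntegral_mono measurable_const fun s hs => ?_)
    · rw [setLIntegral_const]
      exact ENNReal.mul_ne_top ENNReal.ofReal_ne_top (by simp)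
    · rw [← lintegral_eventRate_eq hstat s.toNNReal]
      refine lintegral_mono_ae ?_
      filter_upwards [hsk.ae_followsFlow, hsk.ae_strictMono] with ω hf hmono
      simpa [Real.coe_toNNReal s hs.1] using hf.tsum_stepRate_le hmono (gaussPotential d) s.toNNReal
  filter_upwards [ae_eventually_notMem hfin] with ω hω
  obtain ⟨n, hn⟩ := hω.exists
  exact ⟨n + 1, not_le.1 hn⟩

/-- The expected number of events on `[0, T]`. -/
lemma IsSkeleton.tsum_measure_event_eq
    (hstat : ∀ t, P.map (Z t) = (stdGaussian (E d)).prod (unifSphere d)) (T : ℝ≥0) :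
    ∑' n, P {ω | S (n + 1) ω ≤ T} = ENNReal.ofReal (T / √(2 * Real.pi)) := by
  have h : ∀ s ∈ Icc 0 (T : ℝ), ∫⁻ ω,
      ∑' n, stepRate (gaussPotential d) (fun k => S k ω) (fun k => Y k ω) n s ∂P =
      ENNReal.ofReal (1 / √(2 * Real.pi)) := by
    intro s hs
    rw [← lintegral_eventRate_eq hstat s.toNNReal]
    refine lintegral_congr_ae ?_
    filter_upwards [hsk.ae_followsFlow, hsk.ae_strictMono, hsk.time_zero,
      hsk.ae_exists_lt hstat T] with ω hf hmono h0 ⟨N, hN⟩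
    obtain ⟨n, hn⟩ := exists_mem_Ico_of_lt (S := fun k => S k ω) h0 hs.1 ⟨N, hs.2.trans_lt hN⟩
    rw [← Real.coe_toNNReal s hs.1] at hn
    have := hf.tsum_stepRate_eq hmono (gaussPotential d) hn
    rwa [Real.coe_toNNReal s hs.1] at this
  rw [hsk.tsum_measure_event_le, setLIntegral_congr_fun measurableSet_Icc h, setLIntegral_const,
    Real.volume_Icc, sub_zero, ← ENNReal.ofReal_mul (by positivity), one_div_mul_eq_div]

end Skeleton

end

end FECMC

theorem corollary3p3 (d : ℕ) [NeZero d] {Ω : Type*} [MeasurableSpace Ω] (P : Measure Ω)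
    [IsProbabilityMeasure P]
    (ν : Kernel (FECMC.E d) (Matrix (Fin d) (Fin d) ℝ))
    (hν : FECMC.IsSwitchKernel (FECMC.gaussPotential d) ν)
    (Z : ℝ≥0 → Ω → FECMC.E d × FECMC.E d)
    (hZ : FECMC.IsFECMC P (FECMC.gaussPotential d) ν Z)
    (hstat : ∀ t, P.map (Z t) = (stdGaussian (FECMC.E d)).prod (FECMC.unifSphere d))
    (T : ℝ≥0) (hT : 0 < T) :
    AEMeasurable (fun ω => FECMC.numJumps (fun t => (Z t ω).2) T) P ∧
      ∫⁻ ω, FECMC.numJumps (fun t => (Z t ω).2) T ∂P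
        = ENNReal.ofReal (T / √(2 * Real.pi)) := by
  obtain ⟨S, Y, hsk⟩ := hZ
  have hms : ∀ n, MeasurableSet {ω | S (n + 1) ω ≤ T} := fun n =>
    measurableSet_le (hsk.measurable_time _) measurable_const
  have hind : ∀ n, Measurable ({ω | S (n + 1) ω ≤ T}.indicator (1 : Ω → ℝ≥0∞)) := fun n =>
    measurable_one.indicator (hms n)
  have heq : (fun ω => FECMC.numJumps (fun t => (Z t ω).2) T) =ᵐ[P]
      fun ω => ∑' n, {ω | S (n + 1) ω ≤ T}.indicator 1 ω := by
    filter_upwards [hsk.ae_followsFlow, hsk.ae_strictMono, hsk.time_zero,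
      hsk.ae_exists_lt hstat T, ae_all_iff.2 (hsk.ae_velocity_ne hν)] with ω hf hmono h0 hex hV
    exact hf.numJumps_eq h0 hmono hV hex
  refine ⟨(Measurable.tsum hind).aemeasurable.congr heq.symm, ?_⟩
  rw [lintegral_congr_ae heq, lintegral_tsum fun n => (hind n).aemeasurable,
    ← hsk.tsum_measure_event_eq hstat T]
  exact tsum_congr fun n => lintegral_indicator_one (hms n)
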